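/- Let $\mathbb{Q}^{+}=\{q\in\mathbb{Q} : q>0\}$ and $\mathbb{Q}^{\geq 0}=\{q\in\mathbb{Q} : q\geq 0\}$. In the first-order language with equality whose only non-logical symbol is a binary function symbol $\cdot$, interpreted as multiplication, the theories of the three structures $$\langle\mathbb{Q}^{+},\cdot\rangle,\qquad \langle\mathbb{Q}^{\geq 0},\cdot\rangle,\qquad \langle\mathbb{Q},\cdot\rangle$$ (that is, for each structure, the set of all first-order sentences true in it) are decidable: for each of them there is an algorithm that determines, for every given sentence of this language, whether the sentence is true in the structure. -/

import Mathlib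

/-- The function symbols of the language of multiplication: one binary symbol. -/
inductive MulFunc : ℕ → Type
  | mul : MulFunc 2

/-- The first-order language `{·}` (with equality as a logical symbol): one binary function
symbol, no constants, no relation symbols. -/
def mulLang : FirstOrder.Language.{0, 0} where
  Functions := MulFunc
  Relations := fun _ => Empty

/-- The structure `⟨M, ·⟩`: the function symbol is interpreted as the multiplication of `M`. -/
instance mulStructure (M : Type*) [Mul M] : mulLang.Structure M where
  funMap := fun {_} f =>
    match f with
    | MulFunc.mul => fun v => v 0 * v 1
  RelMap := fun {_} r => r.elim

/-- The Gödel number of a term whose variables are `x₀, …, xₙ₋₁`: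
`xᵢ ↦ 2 i` and `s · t ↦ 2 ⟨s, t⟩ + 1`, with `⟨_, _⟩` the pairing function of `ℕ`. -/
def termCode {n : ℕ} : mulLang.Term (Empty ⊕ Fin n) → ℕ
  | .var (Sum.inl e) => e.elim
  | .var (Sum.inr i) => 2 * (i : ℕ)
  | .func MulFunc.mul ts => 2 * Nat.pair (termCode (ts 0)) (termCode (ts 1)) + 1

/-- The Gödel number of a formula without free variables other than `x₀, …, xₙ₋₁`
(the quantifier in `∀ xₙ, φ` binds the variable `xₙ` of `φ`). -/
def formulaCode : {n : ℕ} → mulLang.BoundedFormula Empty n → ℕ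
  | _, .falsum => 0
  | _, .equal s t => 4 * Nat.pair (termCode s) (termCode t) + 1
  | _, .rel R _ => Empty.elim R
  | _, .imp φ ψ => 4 * Nat.pair (formulaCode φ) (formulaCode ψ) + 2
  | _, .all φ => 4 * formulaCode φ + 3

theorem termCode_injective {n : ℕ} :
    Function.Injective (termCode : mulLang.Term (Empty ⊕ Fin n) → ℕ) := by
  intro s
  induction s with
  | var a =>
    rintro (b | ⟨f, us⟩) h
    · rcases a with a | a
      · exact a.elim
      rcases b with b | b
      · exact b.elim
      simp only [termCode] at h
      have : a = b := Fin.ext (by omega)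
      rw [this]
    · rcases a with a | a
      · exact a.elim
      cases f
      simp only [termCode] at h
      omega
  | func f ts ih =>
    cases f
    rintro (b | ⟨f, us⟩) h
    · rcases b with b | b
      · exact b.elim
      simp only [termCode] at h
      omega
    · cases f
      simp only [termCode] at h
      have h2 := Nat.pair_eq_pair.1 (show Nat.pair (termCode (ts 0)) (termCode (ts 1)) =
        Nat.pair (termCode (us 0)) (termCode (us 1)) by omega)
      congr 1
      funext i
      fin_cases i
      · exact ih 0 h2.1
      · exact ih 1 h2.2

/-- Distinct formulas have distinct Gödel numbers. -/
theorem formulaCode_injective {n : ℕ} :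
    Function.Injective (formulaCode : mulLang.BoundedFormula Empty n → ℕ) := by
  intro φ
  induction φ with
  | falsum =>
    intro ψ h
    cases ψ with
    | falsum => rfl
    | rel R _ => exact Empty.elim R
    | _ => simp only [formulaCode] at h; omega
  | equal s t =>
    intro ψ h
    cases ψ with
    | equal s' t' =>
      simp only [formulaCode] at h
      have h2 := Nat.pair_eq_pair.1 (show Nat.pair (termCode s) (termCode t) =
        Nat.pair (termCode s') (termCode t') by omega)
      rw [termCode_injective h2.1, termCode_injective h2.2]
    | rel R _ => exact Empty.elim R
    | _ => simp only [formulaCode] at h; omega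
  | rel R _ => exact Empty.elim R
  | imp φ₁ φ₂ ih₁ ih₂ =>
    intro ψ h
    cases ψ with
    | imp ψ₁ ψ₂ =>
      simp only [formulaCode] at h
      have h2 := Nat.pair_eq_pair.1 (show Nat.pair (formulaCode φ₁) (formulaCode φ₂) =
        Nat.pair (formulaCode ψ₁) (formulaCode ψ₂) by omega)
      rw [ih₁ h2.1, ih₂ h2.2]
    | rel R _ => exact Empty.elim R
    | _ => simp only [formulaCode] at h; omega
  | all φ ih =>
    intro ψ h
    cases ψ with
    | all ψ =>
      simp only [formulaCode] at h
      rw [ih (show formulaCode φ = formulaCode ψ by omega)]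
    | rel R _ => exact Empty.elim R
    | _ => simp only [formulaCode] at h; omega

/-- A set `T` of sentences of the language `{·}` is decidable: there is an algorithm (a total
recursive function) which decides for each natural number whether it is the Gödel number of a
member of `T`. -/
def IsDecidableTheory (T : mulLang.Theory) : Prop :=
  ComputablePred fun k : ℕ => ∃ φ ∈ T, formulaCode φ = k

/-! Written additively, the positive rationals form a torsion-free abelian group in which any finite
tuple avoids some prime `e`: the `e`-adic valuation kills the tuple and takes the value 1 at `e`. In
such a group, what a formula can say about a tuple is governed by which integer combinations vanish
and which are divisible by given integers. `LinEquiv` is a finite approximation of this information,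
and `LinEquiv.extend` is the back-and-forth step: at the price of larger parameters on the old
tuples, every new `y` on one side is matched by some `y'` on the other. If `y` satisfies a relation
with small coefficients, `y'` solves the transported relation; otherwise `y'` imitates `y` modulo
`L` and is kept out of all relations by the fresh prime.

Decidability comes from the size of the witness. Some positive multiple of `y'` is a combination,
with bounded coefficients, of the old tuple and `e`, so the height of `y'` is bounded by that of the
tuple; Euclid's argument (`exists_independent`) bounds `e`. Zero and negative numbers only require
carrying signs along, since the sign of a term depends on the signs of its variables alone; this is
`RatEquiv.extend`.

Applied to a tuple and itself, the step replaces an arbitrary value of a quantified variable by an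
equivalent one of bounded height. Hence quantifiers may be restricted to explicit finite sets
(`sat_iff_bddSat`), and truth becomes a primitive recursive finite search (`exists_primrec_bddSat`).
All three structures are sets of rationals cut out by sign conditions, so one argument serves them
all. -/

section Algebra

/-! ### Back-and-forth for integer combinations in torsion-free abelian groups. -/

variable {A : Type*} [AddCommGroup A] {n : ℕ}

/-- The integer linear combination `∑ aᵢ xᵢ`. -/
def linComb (a : Fin n → ℤ) (x : Fin n → A) : A := ∑ i, a i • x i

theorem linComb_add (a b : Fin n → ℤ) (x : Fin n → A) :
    linComb (a + b) x = linComb a x + linComb b x := by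
  simp [linComb, add_smul, Finset.sum_add_distrib]

theorem linComb_smul (c : ℤ) (a : Fin n → ℤ) (x : Fin n → A) :
    linComb (c • a) x = c • linComb a x := by
  simp [linComb, mul_smul, Finset.smul_sum]

theorem linComb_neg (a : Fin n → ℤ) (x : Fin n → A) :
    linComb (-a) x = -linComb a x := by
  simp [linComb]

theorem linComb_sub (a b : Fin n → ℤ) (x : Fin n → A) :
    linComb (a - b) x = linComb a x - linComb b x := by
  simp [linComb, sub_smul]

theorem linComb_snoc (a : Fin (n + 1) → ℤ) (x : Fin n → A) (y : A) :
    linComb a (Fin.snoc x y : Fin (n + 1) → A) =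
      linComb (fun i => a i.castSucc) x + a (Fin.last n) • y := by
  simp [linComb, Fin.sum_univ_castSucc]

theorem map_linComb {B : Type*} [AddCommGroup B] (v : A →+ B) (a : Fin n → ℤ) (x : Fin n → A) :
    v (linComb a x) = linComb a (fun i => v (x i)) := by
  simp [linComb]

/-- `w` is divisible by the integer `L` in the group. -/
def DivBy (L : ℤ) (w : A) : Prop := ∃ z, L • z = w

theorem DivBy.add {L : ℤ} {w w' : A} (h : DivBy L w) (h' : DivBy L w') : DivBy L (w + w') := by
  obtain ⟨z, rfl⟩ := h
  obtain ⟨z', rfl⟩ := h'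
  exact ⟨z + z', smul_add _ _ _⟩

theorem DivBy.neg {L : ℤ} {w : A} (h : DivBy L w) : DivBy L (-w) := by
  obtain ⟨z, rfl⟩ := h
  exact ⟨-z, smul_neg _ _⟩

theorem divBy_smul (L : ℤ) (w : A) : DivBy L (L • w) := ⟨w, rfl⟩

theorem DivBy.smul {L : ℤ} {w : A} (c : ℤ) (h : DivBy L w) : DivBy L (c • w) := by
  obtain ⟨z, rfl⟩ := h
  exact ⟨c • z, smul_comm _ _ _⟩

theorem divBy_add_iff {L : ℤ} {w w' : A} (h : DivBy L w') : DivBy L (w + w') ↔ DivBy L w :=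
  ⟨fun h1 => by simpa using h1.add h.neg, fun h1 => h1.add h⟩

theorem smul_cancel [IsAddTorsionFree A] {c : ℤ} (hc : c ≠ 0) {w w' : A} (h : c • w = c • w') :
    w = w' := by
  exact zsmul_right_injective hc h

theorem divBy_mul_smul [IsAddTorsionFree A] {c : ℤ} (hc : c ≠ 0) (L : ℤ) (w : A) :
    DivBy (c * L) (c • w) ↔ DivBy L w := by
  constructor
  · rintro ⟨z, hz⟩
    exact ⟨z, smul_cancel hc (by rw [← hz, mul_smul])⟩
  · rintro ⟨z, rfl⟩
    exact ⟨z, mul_smul _ _ _⟩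

/-- Two tuples have the same `L`-divisible integer combinations, and the same vanishing integer
combinations among those with coefficients at most `C` in absolute value. -/
structure LinEquiv (L C : ℕ) (x x' : Fin n → A) : Prop where
  div : ∀ a, DivBy L (linComb a x) ↔ DivBy L (linComb a x')
  zero : ∀ a, (∀ i, |a i| ≤ (C : ℤ)) → (linComb a x = 0 ↔ linComb a x' = 0)

theorem LinEquiv.refl (L C : ℕ) (x : Fin n → A) : LinEquiv L C x x :=
  ⟨fun _ => Iff.rfl, fun _ _ => Iff.rfl⟩

theorem LinEquiv.symm {L C : ℕ} {x x' : Fin n → A} (h : LinEquiv L C x x') : LinEquiv L C x' x :=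
  ⟨fun a => (h.div a).symm, fun a ha => (h.zero a ha).symm⟩

/-- If `L' = L * c`, then `L` divides `w` exactly when `L'` divides `c • w`, and `c • w` is again a
combination of the tuple. Thus one modulus controls all its divisors. -/
theorem LinEquiv.div_of_dvd [IsAddTorsionFree A] {L L' C : ℕ} {x x' : Fin n → A}
    (h : LinEquiv L' C x x') (hL' : L' ≠ 0) (hd : (L : ℤ) ∣ L') (a : Fin n → ℤ) :
    DivBy L (linComb a x) ↔ DivBy L (linComb a x') := by
  obtain ⟨c, hc⟩ := hd
  have hc0 : c ≠ 0 := by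
    rintro rfl
    simp at hc
    exact hL' hc
  rw [← divBy_mul_smul hc0, ← divBy_mul_smul hc0 _ (linComb a x'), mul_comm c, ← hc,
    ← linComb_smul, ← linComb_smul]
  exact h.div _

/-- Extending by an element algebraic over the tuple. -/
theorem LinEquiv.extend_algebraic [IsAddTorsionFree A] {L C : ℕ} (hL : 0 < L) {x x' : Fin n → A}
    (h : LinEquiv (L * C.factorial) (2 * C ^ 2) x x') {y : A} {b : ℕ} (hb : 0 < b) (hbC : b ≤ C)
    {a : Fin n → ℤ} (ha : ∀ i, |a i| ≤ (C : ℤ)) (hy : (b : ℤ) • y = linComb a x) :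
    ∃ y', LinEquiv L C (Fin.snoc x y : Fin (n + 1) → A) (Fin.snoc x' y') ∧
      (b : ℤ) • y' = linComb a x' := by
  have hb0 : (b : ℤ) ≠ 0 := by positivity
  have hLC : L * C.factorial ≠ 0 := (Nat.mul_pos hL (Nat.factorial_pos _)).ne'
  have hbd : b ∣ C.factorial := Nat.dvd_factorial hb hbC
  -- The factor `C!` in the modulus is there so that divisibility by any `b ≤ C` transfers.
  obtain ⟨y', hy'⟩ : DivBy (b : ℤ) (linComb a x') :=
    (h.div_of_dvd hLC (by exact_mod_cast hbd.mul_left _) a).1 ⟨y, hy⟩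
  -- Multiplying by `b` eliminates the new element. It raises the modulus from `L` to `b * L` and
  -- the coefficients from `C` to at most `2 * C ^ 2`.
  have key : ∀ (z : Fin n → A) (w : A), (b : ℤ) • w = linComb a z → ∀ d : Fin (n + 1) → ℤ,
      (b : ℤ) • linComb d (Fin.snoc z w : Fin (n + 1) → A) =
        linComb ((b : ℤ) • (fun i => d i.castSucc) + d (Fin.last n) • a) z := by
    intro z w hw d
    rw [linComb_snoc, linComb_add, linComb_smul, linComb_smul, ← hw, smul_add, smul_comm]
  refine ⟨y', ⟨fun d => ?_, fun d hd => ?_⟩, hy'⟩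
  · have h1 := h.div_of_dvd (L := b * L) hLC
      (by rw [mul_comm b]; exact_mod_cast Nat.mul_dvd_mul_left L hbd)
      ((b : ℤ) • (fun i => d i.castSucc) + d (Fin.last n) • a)
    rw [← key x y hy d, ← key x' y' hy' d] at h1
    push_cast at h1
    rwa [divBy_mul_smul hb0, divBy_mul_smul hb0] at h1
  · have h1 := h.zero ((b : ℤ) • (fun i => d i.castSucc) + d (Fin.last n) • a) (fun i => by
      have e1 := hd i.castSucc
      have e2 := hd (Fin.last n)
      have e3 := ha i
      have e4 : (b : ℤ) ≤ C := by exact_mod_cast hbC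
      have e5 : (0 : ℤ) ≤ b := by positivity
      simp only [Pi.add_apply, Pi.smul_apply, smul_eq_mul]
      calc _ ≤ |(b : ℤ) * d i.castSucc| + |d (Fin.last n) * a i| := abs_add_le _ _
        _ = b * |d i.castSucc| + |d (Fin.last n)| * |a i| := by
          rw [abs_mul, abs_mul, abs_of_nonneg e5]
        _ ≤ C * C + C * C := by gcongr
        _ = _ := by push_cast; ring)
    rw [← key x y hy d, ← key x' y' hy' d] at h1
    have e : ∀ w : A, (b : ℤ) • w = 0 ↔ w = 0 := fun w =>
      ⟨fun hw => smul_cancel hb0 (by rw [hw, smul_zero]), fun hw => by rw [hw, smul_zero]⟩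
    rwa [e, e] at h1

/-- Extending by an element which is not algebraic over the tuple within the bound `C`. -/
theorem LinEquiv.extend_generic [IsAddTorsionFree A] {L C L' C' : ℕ} (hL : 0 < L) (hL' : 0 < L')
    (hLL : L ∣ L') (hCC : C ≤ C') {x x' : Fin n → A} (h : LinEquiv L' C' x x') {y : A}
    (hy : ∀ (b : ℤ) (a : Fin n → ℤ), b ≠ 0 → |b| ≤ C → (∀ i, |a i| ≤ (C : ℤ)) →
      linComb a x + b • y ≠ 0)
    {e : A} (v : A →+ ℤ) (hv : ∀ i, v (x' i) = 0) (he : v e = 1) :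
    ∃ y', LinEquiv L C (Fin.snoc x y : Fin (n + 1) → A) (Fin.snoc x' y') ∧
      ∃ (g : ℕ) (a : Fin n → ℤ), 0 < g ∧ g ≤ L ∧ (∀ i, |a i| ≤ (L : ℤ)) ∧
        (g : ℤ) • y' = linComb a x' + (L : ℤ) • e := by
  have hL0 : (L : ℤ) ≠ 0 := by positivity
  -- The integers `b` for which `b • y` is, modulo `L`, a combination of `x`. The subgroup contains
  -- `L`, so its generator `g` divides `L`.
  let I : AddSubgroup ℤ :=
    { carrier := {b | ∃ a : Fin n → ℤ, DivBy (L : ℤ) (linComb a x + b • y)}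
      zero_mem' := ⟨0, 0, by simp [linComb]⟩
      add_mem' := by
        rintro b b' ⟨a, ha⟩ ⟨a', ha'⟩
        refine ⟨a + a', ?_⟩
        have := ha.add ha'
        rw [linComb_add, add_smul]
        convert this using 1
        abel
      neg_mem' := by
        rintro b ⟨a, ha⟩
        refine ⟨-a, ?_⟩
        have := ha.neg
        rw [linComb_neg, neg_smul]
        convert this using 1
        abel }
  obtain ⟨g₀, hg₀⟩ := Int.subgroup_cyclic I
  have hmem : ∀ b, b ∈ I ↔ g₀ ∣ b := by
    intro b
    rw [hg₀, AddSubgroup.mem_closure_singleton]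
    constructor
    · rintro ⟨c, rfl⟩
      exact ⟨c, by rw [smul_eq_mul, mul_comm]⟩
    · rintro ⟨c, rfl⟩
      exact ⟨c, by rw [smul_eq_mul, mul_comm]⟩
  have hLI : (L : ℤ) ∈ I := ⟨0, by simpa [linComb] using divBy_smul (L : ℤ) y⟩
  set g : ℕ := g₀.natAbs with hg
  have hmem' : ∀ b, b ∈ I ↔ (g : ℤ) ∣ b := fun b => by rw [hmem, hg, Int.natAbs_dvd]
  have hgL : g ∣ L := by exact_mod_cast (hmem' _).1 hLI
  have hgpos : 0 < g := Nat.pos_of_dvd_of_pos hgL hL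
  have hg0 : (g : ℤ) ≠ 0 := by positivity
  obtain ⟨a₀, ha₀⟩ : (g : ℤ) ∈ I := (hmem' _).2 dvd_rfl
  obtain ⟨a, haL, ha⟩ : ∃ a : Fin n → ℤ, (∀ i, |a i| ≤ (L : ℤ)) ∧
      DivBy (L : ℤ) (linComb (-a) x + (g : ℤ) • y) := by
    -- Only residues modulo `L` matter; reducing them bounds the coefficients independently of the
    -- tuple.
    refine ⟨fun i => (-a₀ i) % L, fun i => ?_, ?_⟩
    · rw [abs_of_nonneg (Int.emod_nonneg _ hL0)]
      exact (Int.emod_lt_of_pos _ (by positivity)).le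
    · have : (-fun i => (-a₀ i) % L : Fin n → ℤ) = a₀ + (L : ℤ) • (fun i => (-a₀ i) / (L : ℤ)) := by
        funext i
        have := Int.emod_add_mul_ediv (-a₀ i) L
        simp only [Pi.neg_apply, Pi.add_apply, Pi.smul_apply, smul_eq_mul]
        linarith
      rw [this, linComb_add, linComb_smul, add_right_comm]
      exact ha₀.add (divBy_smul _ _)
  obtain ⟨m, hm⟩ := hgL
  have hm0 : (m : ℤ) ≠ 0 := by
    rintro h0
    have : m = 0 := by exact_mod_cast h0
    rw [this] at hm
    omega
  have hLgm : (L : ℤ) = g * m := by exact_mod_cast hm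
  -- With `L = g * m`, the relation `g • y - linComb a x = L • z` gives `linComb a x = g • (y - m •
  -- z)`. This transfers to `x'` and yields `y₀`; the witness is `y₀ + m • e`, on which `v` takes
  -- the value `m`.
  have hax : DivBy (g : ℤ) (linComb a x) := by
    obtain ⟨z, hz⟩ := ha
    refine ⟨y - (m : ℤ) • z, ?_⟩
    rw [linComb_neg] at hz
    rw [smul_sub, ← mul_smul, ← hLgm, hz]
    abel
  obtain ⟨y₀, hy₀⟩ := (h.div_of_dvd hL'.ne'
    (by exact_mod_cast (Dvd.intro _ hm.symm).trans hLL) a).1 hax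
  have hgy : (g : ℤ) • (y₀ + (m : ℤ) • e) = linComb a x' + (L : ℤ) • e := by
    rw [smul_add, hy₀, ← mul_smul, ← hLgm]
  have hvx : ∀ d : Fin n → ℤ, v (linComb d x') = 0 := fun d => by
    rw [map_linComb]
    simp [linComb, hv]
  have hvy : v (y₀ + (m : ℤ) • e) = m := by
    have : (g : ℤ) * v y₀ = 0 := by rw [← smul_eq_mul, ← map_zsmul, hy₀, hvx]
    have h0 : v y₀ = 0 := (mul_eq_zero.1 this).resolve_left hg0
    simp [h0, he]
  refine ⟨y₀ + (m : ℤ) • e, ⟨fun d => ?_, fun d hd => ?_⟩, g, a, hgpos,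
    Nat.le_of_dvd hL (Dvd.intro _ hm.symm), haL, hgy⟩
  · rw [linComb_snoc, linComb_snoc]
    set d' : Fin n → ℤ := fun i => d i.castSucc
    set b := d (Fin.last n)
    -- If `g ∣ b`, the last coordinate can be traded for a combination of the old ones modulo `L`.
    -- Otherwise neither side is divisible: on the left by the choice of `g`, on the right because
    -- `v` would give `g * m ∣ b * m`.
    by_cases hgb : (g : ℤ) ∣ b
    · obtain ⟨c, hc⟩ := hgb
      have e1 : linComb d' x + b • y =
          linComb (d' + c • a) x + c • (linComb (-a) x + (g : ℤ) • y) := by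
        rw [linComb_add, linComb_smul, linComb_neg, hc, mul_comm, mul_smul, smul_add, smul_neg]
        abel
      have e2 : linComb d' x' + b • (y₀ + (m : ℤ) • e) =
          linComb (d' + c • a) x' + (L : ℤ) • (c • e) := by
        rw [linComb_add, linComb_smul, hc, mul_comm, mul_smul, hgy, smul_add, smul_comm c (L : ℤ) e]
        abel
      rw [e1, e2, divBy_add_iff (ha.smul c), divBy_add_iff (divBy_smul _ _)]
      exact h.div_of_dvd hL'.ne' (by exact_mod_cast hLL) _
    · constructor
      · intro hd
        exact absurd ((hmem' b).1 ⟨d', hd⟩) hgb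
      · rintro ⟨z, hz⟩
        have h1 := congrArg v hz
        rw [map_add, hvx, map_zsmul, map_zsmul, hvy, zero_add, smul_eq_mul, smul_eq_mul, hLgm] at h1
        refine absurd ⟨v z, ?_⟩ hgb
        apply mul_right_cancel₀ hm0
        linarith
  · rw [linComb_snoc, linComb_snoc]
    by_cases hb : d (Fin.last n) = 0
    · rw [hb]
      simp only [zero_smul, add_zero]
      exact h.zero _ fun i => (hd _).trans (by exact_mod_cast hCC)
    -- A relation that involves the last coordinate is excluded on the left by genericity and on the
    -- right because `v` sends it to a nonzero multiple of `m`.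
    · refine iff_of_false (hy _ _ hb (hd _) fun i => hd _) fun h0 => ?_
      have h1 := congrArg v h0
      rw [map_add, hvx, map_zsmul, hvy, zero_add, map_zero, smul_eq_mul] at h1
      exact (mul_ne_zero hb hm0) h1

/-- The back-and-forth property, with an explicitly bounded choice on the second side: `e` is an
element independent of the second tuple. -/
theorem LinEquiv.extend [IsAddTorsionFree A] {L C : ℕ} (hL : 0 < L) (hC : 0 < C)
    {x x' : Fin n → A} (h : LinEquiv (L * C.factorial) (2 * C ^ 2) x x') (y : A)
    {e : A} (v : A →+ ℤ) (hv : ∀ i, v (x' i) = 0) (he : v e = 1) :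
    ∃ y', LinEquiv L C (Fin.snoc x y : Fin (n + 1) → A) (Fin.snoc x' y') ∧
      ∃ (b : ℕ) (a : Fin n → ℤ) (c : ℕ), 0 < b ∧ (∀ i, |a i| ≤ (L + C : ℤ)) ∧ c ≤ L ∧
        b • y' = linComb a x' + c • e := by
  by_cases hy : ∀ (b : ℤ) (a : Fin n → ℤ), b ≠ 0 → |b| ≤ C → (∀ i, |a i| ≤ (C : ℤ)) →
      linComb a x + b • y ≠ 0
  · obtain ⟨y', h1, g, a, hg, -, ha, h2⟩ := h.extend_generic (C := C) hL
      (Nat.mul_pos hL (Nat.factorial_pos _)) (dvd_mul_right _ _) (by nlinarith) hy v hv he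
    exact ⟨y', h1, g, a, L, hg, fun i => (ha i).trans (by simp), le_rfl, by simpa using h2⟩
  · push Not at hy
    obtain ⟨b, a, hb, hbC, ha, hab⟩ := hy
    rw [Int.abs_eq_natAbs] at hbC
    -- The relation is normalised to a positive coefficient of `y`.
    obtain ⟨b', a', hb', hbC', ha', hab'⟩ : ∃ (b' : ℕ) (a' : Fin n → ℤ), 0 < b' ∧ b' ≤ C ∧
        (∀ i, |a' i| ≤ (C : ℤ)) ∧ (b' : ℤ) • y = linComb a' x := by
      rcases lt_or_gt_of_ne hb with h0 | h0
      · refine ⟨b.natAbs, a, by omega, by omega, ha, ?_⟩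
        have : ((b.natAbs : ℕ) : ℤ) = -b := by omega
        rw [this, neg_smul]
        exact (eq_neg_of_add_eq_zero_left hab).symm
      · refine ⟨b.natAbs, -a, by omega, by omega, fun i => by simpa using ha i, ?_⟩
        have : ((b.natAbs : ℕ) : ℤ) = b := by omega
        rw [this, linComb_neg]
        exact eq_neg_of_add_eq_zero_right hab
    obtain ⟨y', h1, h2⟩ := h.extend_algebraic hL hb' hbC' ha' hab'
    exact ⟨y', h1, b', a', 0, hb', fun i => (ha' i).trans (by simp), by omega, by simpa using h2⟩

end Algebra

/-! ### Signs, absolute values, heights and valuations of rationals. -/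

section Rationals

/-- The multiplicative group of positive rationals, written additively. -/
abbrev PosRat : Type := Additive {q : ℚ // 0 < q}

/-- The absolute value of a nonzero rational, as an element of the group of positive rationals;
`0` is sent to the neutral element. -/
def absPart (q : ℚ) : PosRat := .ofMul (if h : q = 0 then 1 else ⟨|q|, abs_pos.2 h⟩)

theorem absPart_zero : absPart 0 = 0 := by
  simp [absPart]

theorem absPart_neg (q : ℚ) : absPart (-q) = absPart q := by
  simp [absPart]

theorem coe_absPart {q : ℚ} (h : q ≠ 0) : ((absPart q).toMul : ℚ) = |q| := by
  simp [absPart, h]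

theorem absPart_coe (z : PosRat) : absPart (z.toMul : ℚ) = z := by
  apply Additive.toMul.injective
  apply Subtype.ext
  rw [coe_absPart z.toMul.2.ne', abs_of_pos z.toMul.2]

theorem absPart_mul {q r : ℚ} (hq : q ≠ 0) (hr : r ≠ 0) :
    absPart (q * r) = absPart q + absPart r := by
  apply Additive.toMul.injective
  apply Subtype.ext
  rw [coe_absPart (mul_ne_zero hq hr), toMul_add, Positive.val_mul, coe_absPart hq, coe_absPart hr,
    abs_mul]

theorem eq_iff_sign_absPart {q r : ℚ} :
    q = r ↔ SignType.sign q = SignType.sign r ∧ absPart q = absPart r := by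
  refine ⟨fun h => h ▸ ⟨rfl, rfl⟩, fun ⟨h1, h2⟩ => ?_⟩
  by_cases hq : q = 0
  · rw [hq, sign_zero, eq_comm, sign_eq_zero_iff] at h1
    rw [hq, h1]
  · have hr : r ≠ 0 := by
      rintro rfl
      rw [sign_zero, sign_eq_zero_iff] at h1
      exact hq h1
    have := congrArg (fun z : PosRat => (z.toMul : ℚ)) h2
    simp only [coe_absPart hq, coe_absPart hr] at this
    rw [← sign_mul_abs q, ← sign_mul_abs r, h1, this]

/-- The naive height of a rational. -/
def ratHeight (q : ℚ) : ℕ := max q.num.natAbs q.den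

theorem one_le_ratHeight (q : ℚ) : 1 ≤ ratHeight q :=
  le_max_of_le_right q.den_pos

theorem ratHeight_mul_le (q r : ℚ) : ratHeight (q * r) ≤ ratHeight q * ratHeight r := by
  have h1 : (q * r).den ∣ q.den * r.den := Rat.mul_den_dvd q r
  apply max_le
  · calc (q * r).num.natAbs ≤ (q.num * r.num).natAbs := by
          rw [Rat.mul_num]
          exact Int.natAbs_ediv_le_natAbs _ _
      _ = q.num.natAbs * r.num.natAbs := Int.natAbs_mul _ _
      _ ≤ _ := Nat.mul_le_mul (le_max_left _ _) (le_max_left _ _)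
  · exact (Nat.le_of_dvd (Nat.mul_pos q.den_pos r.den_pos) h1).trans
      (Nat.mul_le_mul (le_max_right _ _) (le_max_right _ _))

/-- Powers of a coprime numerator and denominator stay coprime. Equality, not just an upper bound,
is what makes roots controllable. -/
theorem ratHeight_pow (q : ℚ) (c : ℕ) : ratHeight (q ^ c) = ratHeight q ^ c := by
  rw [ratHeight, ratHeight, Rat.num_pow, Rat.den_pow, Int.natAbs_pow]
  exact ((pow_left_mono c).map_max).symm

theorem ratHeight_neg (q : ℚ) : ratHeight (-q) = ratHeight q := by
  simp [ratHeight]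

theorem ratHeight_inv (q : ℚ) (hq : 0 < q) : ratHeight q⁻¹ = ratHeight q := by
  have hn : 0 < q.num := Rat.num_pos.2 hq
  rw [ratHeight, ratHeight, max_comm, Rat.den_inv, Rat.num_inv, if_neg hn.ne',
    Int.sign_eq_one_of_pos hn]
  simp

theorem ratHeight_abs (q : ℚ) : ratHeight |q| = ratHeight q := by
  rcases abs_choice q with h | h <;> rw [h]
  exact ratHeight_neg q

/-- The height of a positive rational. -/
def posHeight (z : PosRat) : ℕ := ratHeight (z.toMul : ℚ)

theorem posHeight_zero : posHeight 0 = 1 := by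
  simp [posHeight, ratHeight]

theorem posHeight_add_le (z w : PosRat) : posHeight (z + w) ≤ posHeight z * posHeight w := by
  rw [posHeight, toMul_add, Positive.val_mul]
  exact ratHeight_mul_le _ _

theorem posHeight_nsmul (c : ℕ) (z : PosRat) : posHeight (c • z) = posHeight z ^ c := by
  rw [posHeight, toMul_nsmul, Positive.val_pow, ratHeight_pow, posHeight]

theorem posHeight_neg (z : PosRat) : posHeight (-z) = posHeight z := by
  rw [posHeight, toMul_neg, Positive.coe_inv, ratHeight_inv _ z.toMul.2, posHeight]

theorem posHeight_zsmul (c : ℤ) (z : PosRat) : posHeight (c • z) = posHeight z ^ c.natAbs := by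
  rcases Int.natAbs_eq c with h | h
  · conv_lhs => rw [h]
    rw [natCast_zsmul, posHeight_nsmul]
  · conv_lhs => rw [h]
    rw [neg_smul, posHeight_neg, natCast_zsmul, posHeight_nsmul]

theorem posHeight_linComb_le {n W K : ℕ} {a : Fin n → ℤ} {x : Fin n → PosRat}
    (hx : ∀ i, posHeight (x i) ≤ W) (ha : ∀ i, |a i| ≤ (K : ℤ)) (hW : 1 ≤ W) :
    posHeight (linComb a x) ≤ (W ^ K) ^ n := by
  induction n with
  | zero => simp [linComb, posHeight_zero]
  | succ n ih =>
    have := linComb_snoc a (fun i => x i.castSucc) (x (Fin.last n))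
    rw [show (Fin.snoc (fun i => x i.castSucc) (x (Fin.last n)) : Fin (n + 1) → PosRat) = x from
      Fin.snoc_init_self x] at this
    rw [this, pow_succ]
    refine (posHeight_add_le _ _).trans (Nat.mul_le_mul (ih (fun i => hx _) fun i => ha _) ?_)
    rw [posHeight_zsmul]
    have h1 := ha (Fin.last n)
    rw [Int.abs_eq_natAbs] at h1
    exact (Nat.pow_le_pow_left (hx _) _).trans (Nat.pow_le_pow_right hW (by exact_mod_cast h1))

/-- Extracting roots does not increase the height, so a witness known only through a positive
multiple is still bounded. -/
theorem posHeight_le_nsmul {b : ℕ} (hb : 0 < b) (z : PosRat) : posHeight z ≤ posHeight (b • z) := by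
  rw [posHeight_nsmul]
  exact Nat.le_self_pow hb.ne' _

theorem ratHeight_sign_mul_le (s : SignType) (q : ℚ) : ratHeight ((s : ℚ) * q) ≤ ratHeight q := by
  cases s with
  | zero => simpa [ratHeight] using one_le_ratHeight q
  | neg => simp [ratHeight_neg]
  | pos => simp

theorem posHeight_absPart_le (q : ℚ) : posHeight (absPart q) ≤ ratHeight q := by
  by_cases hq : q = 0
  · rw [hq, absPart_zero, posHeight_zero]
    exact one_le_ratHeight _
  · rw [posHeight, coe_absPart hq, ratHeight_abs]

/-- The `p`-adic valuation on the group of positive rationals. -/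
def posVal (p : ℕ) [Fact p.Prime] : PosRat →+ ℤ where
  toFun z := padicValRat p (z.toMul : ℚ)
  map_zero' := by simp
  map_add' z w := by
    rw [toMul_add, Positive.val_mul, padicValRat.mul z.toMul.2.ne' w.toMul.2.ne']

theorem posVal_eq_zero {p : ℕ} [Fact p.Prime] {z : PosRat} (h : posHeight z < p) :
    posVal p z = 0 := by
  have h1 := (le_max_left _ _).trans_lt h
  have h2 := (le_max_right _ _).trans_lt h
  have h3 : 0 < (z.toMul : ℚ).num := Rat.num_pos.2 z.toMul.2
  show padicValRat p (z.toMul : ℚ) = 0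
  rw [padicValRat, padicValInt, padicValNat.eq_zero_of_not_dvd, padicValNat.eq_zero_of_not_dvd]
  · simp
  · exact fun hd => (Nat.le_of_dvd (Rat.den_pos _) hd).not_gt h2
  · exact fun hd => (Nat.le_of_dvd (Int.natAbs_pos.2 h3.ne') hd).not_gt h1

/-- A positive rational of controlled height which is multiplicatively independent of all positive
rationals of height at most `W`. -/
theorem exists_independent (W : ℕ) : ∃ (e : PosRat) (v : PosRat →+ ℤ),
    v e = 1 ∧ (∀ z, posHeight z ≤ W → v z = 0) ∧ posHeight e ≤ W.factorial + 1 := by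
  have hne : W.factorial + 1 ≠ 1 := by simp [Nat.factorial_ne_zero]
  set p := (W.factorial + 1).minFac
  have : Fact p.Prime := ⟨Nat.minFac_prime hne⟩
  have hp : p.Prime := Fact.out
  -- Euclid's argument: a prime up to `W` divides `W!`, hence not `W! + 1`.
  have hW : W < p := by
    by_contra! hle
    have h1 : p ∣ W.factorial := (Nat.Prime.dvd_factorial hp).2 hle
    have h2 : p ∣ W.factorial + 1 := Nat.minFac_dvd _
    exact hp.one_lt.ne' (Nat.dvd_one.1 ((Nat.dvd_add_right h1).1 h2))
  refine ⟨.ofMul ⟨(p : ℚ), by exact_mod_cast hp.pos⟩, posVal p, ?_, fun z hz =>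
    posVal_eq_zero (hz.trans_lt hW), ?_⟩
  · exact padicValRat.self hp.one_lt
  · have : p ≤ W.factorial + 1 := Nat.minFac_le (by positivity)
    simpa [posHeight, ratHeight] using this

end Rationals

/-! ### Truth in sets of rationals, and bounding the quantifiers. -/

section Semantics

open FirstOrder Language

variable {n : ℕ}

/-- The value of a term in the multiplicative structure of the rationals. -/
def termVal (x : Fin n → ℚ) (t : mulLang.Term (Empty ⊕ Fin n)) : ℚ :=
  t.realize (Sum.elim (default : Empty → ℚ) x)

/-- The number of occurrences of each variable in a term. -/
def countVar : mulLang.Term (Empty ⊕ Fin n) → Fin n → ℤ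
  | .var (Sum.inl e) => e.elim
  | .var (Sum.inr i) => Pi.single i 1
  | .func MulFunc.mul ts => countVar (ts 0) + countVar (ts 1)

theorem termVal_var (x : Fin n → ℚ) (i : Fin n) : termVal x (.var (Sum.inr i)) = x i := rfl

theorem termVal_mul (x : Fin n → ℚ) (ts : Fin 2 → mulLang.Term (Empty ⊕ Fin n)) :
    termVal x (.func MulFunc.mul ts) = termVal x (ts 0) * termVal x (ts 1) := rfl

theorem term_induction {p : mulLang.Term (Empty ⊕ Fin n) → Prop}
    (hvar : ∀ i, p (.var (Sum.inr i)))
    (hmul : ∀ ts, p (ts 0) → p (ts 1) → p (.func MulFunc.mul ts)) (t) : p t := by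
  induction t with
  | var a =>
    rcases a with a | i
    · exact a.elim
    · exact hvar i
  | func f ts ih =>
    cases f
    exact hmul ts (ih 0) (ih 1)

theorem linComb_single (i : Fin n) {A : Type*} [AddCommGroup A] (x : Fin n → A) :
    linComb (Pi.single i 1) x = x i := by
  simp [linComb, Pi.single_apply]

theorem absPart_termVal (x : Fin n → ℚ) (t : mulLang.Term (Empty ⊕ Fin n)) (h : termVal x t ≠ 0) :
    absPart (termVal x t) = linComb (countVar t) (absPart ∘ x) := by
  induction t using term_induction with
  | hvar i => simp [termVal_var, countVar, linComb_single]
  | hmul ts h0 h1 =>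
    rw [termVal_mul] at h ⊢
    have := mul_ne_zero_iff.1 h
    rw [absPart_mul this.1 this.2, h0 this.1, h1 this.2, countVar, linComb_add]

theorem sign_termVal {x x' : Fin n → ℚ} (h : ∀ i, SignType.sign (x i) = SignType.sign (x' i))
    (t : mulLang.Term (Empty ⊕ Fin n)) :
    SignType.sign (termVal x t) = SignType.sign (termVal x' t) := by
  induction t using term_induction with
  | hvar i => exact h i
  | hmul ts h0 h1 => rw [termVal_mul, termVal_mul, sign_mul, sign_mul, h0, h1]

theorem countVar_nonneg (t : mulLang.Term (Empty ⊕ Fin n)) (i : Fin n) : 0 ≤ countVar t i := by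
  induction t using term_induction with
  | hvar j =>
    simp only [countVar, Pi.single_apply]
    split_ifs <;> simp
  | hmul ts h0 h1 => exact add_nonneg h0 h1

/-- The `+ 1` is needed since `x₀` has code `0`; it explains the initial coefficient bound `k + 1`
in `level`. -/
theorem countVar_le (t : mulLang.Term (Empty ⊕ Fin n)) (i : Fin n) :
    countVar t i ≤ termCode t + 1 := by
  induction t using term_induction with
  | hvar j =>
    simp only [countVar, Pi.single_apply]
    split_ifs <;> omega
  | hmul ts h0 h1 =>
    have := Nat.add_le_pair (termCode (ts 0)) (termCode (ts 1))
    simp only [countVar, termCode, Pi.add_apply]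
    push_cast
    zify at this
    linarith

/-- Truth of a formula in the multiplicative structure on a set `S` of rationals. -/
def Sat (S : Set ℚ) : {n : ℕ} → mulLang.BoundedFormula Empty n → (Fin n → ℚ) → Prop
  | _, .falsum, _ => False
  | _, .equal s t, x => termVal x s = termVal x t
  | _, .rel R _, _ => Empty.elim R
  | _, .imp φ ψ, x => Sat S φ x → Sat S ψ x
  | _, .all φ, x => ∀ q ∈ S, Sat S φ (Fin.snoc x q)

theorem map_realize_term {M : Type*} [Mul M] (f : M →ₙ* ℚ) (x : Fin n → M)
    (t : mulLang.Term (Empty ⊕ Fin n)) :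
    f (t.realize (Sum.elim (default : Empty → M) x)) = termVal (f ∘ x) t := by
  induction t using term_induction with
  | hvar i => rfl
  | hmul ts h0 h1 =>
    rw [termVal_mul, ← h0, ← h1, ← map_mul]
    rfl

/-- An injective multiplicative map turns quantifiers over `M` into quantifiers over its range,
which places all three structures inside `ℚ`. -/
theorem realize_iff_sat {M : Type*} [Mul M] (f : M →ₙ* ℚ) (hf : Function.Injective f)
    (φ : mulLang.BoundedFormula Empty n) (x : Fin n → M) :
    φ.Realize default x ↔ Sat (Set.range f) φ (f ∘ x) := by
  induction φ with
  | falsum => rfl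
  | equal s t =>
    rw [Sat, ← map_realize_term, ← map_realize_term, hf.eq_iff]
    rfl
  | rel R _ => exact Empty.elim R
  | imp φ ψ h1 h2 => rw [Sat, ← h1, ← h2, BoundedFormula.realize_imp]
  | all φ ih =>
    simp only [Sat, BoundedFormula.realize_all, ih, Set.forall_mem_range, Fin.comp_snoc]

/-- The divisibility and coefficient parameters of the equivalence of tuples which is preserved by
formulas with at most `j` nested quantifiers and code at most `k`. -/
def level (k : ℕ) : ℕ → ℕ × ℕ
  | 0 => (1, k + 1)
  | j + 1 => ((level k j).1 * (level k j).2.factorial, 2 * (level k j).2 ^ 2)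

theorem level_pos (k j : ℕ) : 0 < (level k j).1 := by
  induction j with
  | zero => simp [level]
  | succ j ih => exact Nat.mul_pos ih (Nat.factorial_pos _)

theorem lt_level (k j : ℕ) : k < (level k j).2 := by
  induction j with
  | zero => simp [level]
  | succ j ih =>
    simp only [level]
    nlinarith

/-- Tuples of rationals with the same signs and equivalent absolute values. -/
structure RatEquiv (k j : ℕ) (x x' : Fin n → ℚ) : Prop where
  sign : ∀ i, SignType.sign (x i) = SignType.sign (x' i)
  lin : LinEquiv (level k j).1 (level k j).2 (absPart ∘ x) (absPart ∘ x')

theorem RatEquiv.refl (k j : ℕ) (x : Fin n → ℚ) : RatEquiv k j x x :=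
  ⟨fun _ => rfl, .refl _ _ _⟩

theorem RatEquiv.symm {k j : ℕ} {x x' : Fin n → ℚ} (h : RatEquiv k j x x') : RatEquiv k j x' x :=
  ⟨fun i => (h.sign i).symm, h.lin.symm⟩

/-- A bound for the height of the witness in the back-and-forth property, in terms of a bound `W`
for the heights of the `n` parameters. -/
def witnessBound (k j n W : ℕ) : ℕ :=
  (W ^ ((level k j).1 + (level k j).2)) ^ n * (W.factorial + 1) ^ (level k j).1

theorem RatEquiv.extend {k j W : ℕ} {x x' : Fin n → ℚ} (h : RatEquiv k (j + 1) x x') (y : ℚ)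
    (hW : 1 ≤ W) (hx' : ∀ i, ratHeight (x' i) ≤ W) :
    ∃ y', RatEquiv k j (Fin.snoc x y : Fin (n + 1) → ℚ) (Fin.snoc x' y') ∧
      SignType.sign y' = SignType.sign y ∧ ratHeight y' ≤ witnessBound k j n W := by
  obtain ⟨e, v, hve, hv, he⟩ := exists_independent W
  have hxW : ∀ i, posHeight ((absPart ∘ x') i) ≤ W := fun i =>
    (posHeight_absPart_le _).trans (hx' i)
  have hC : 0 < (level k j).2 := (Nat.zero_le k).trans_lt (lt_level k j)
  obtain ⟨z, hz, b, a, c, hb, ha, hc, hbz⟩ := h.lin.extend (level_pos k j) hC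
    (absPart y) v (fun i => hv _ (hxW i)) hve
  have hsign : SignType.sign ((SignType.sign y : ℚ) * (z.toMul : ℚ)) = SignType.sign y := by
    rw [sign_mul, sign_pos z.toMul.2, mul_one]
    cases SignType.sign y <;> simp
  have habs : absPart ((SignType.sign y : ℚ) * (z.toMul : ℚ)) = z := by
    rcases lt_trichotomy y 0 with hy | hy | hy
    · rw [sign_neg hy, SignType.coe_neg_one, neg_one_mul, absPart_neg, absPart_coe]
    -- For `y = 0` the value `absPart y` is neutral, and the vanishing clause for the last
    -- coordinate forces `z` to be neutral too, in accordance with `absPart 0 = 0`.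
    · have h1 := (hz.zero (Pi.single (Fin.last n) 1) fun i => by
        rw [Pi.single_apply]
        split_ifs <;> simp
        exact_mod_cast hC).1 (by simp [linComb_single, hy, absPart_zero])
      rw [linComb_single, Fin.snoc_last] at h1
      rw [hy, h1]
      simp [absPart_zero]
    · rw [sign_pos hy]
      simpa using absPart_coe z
  refine ⟨SignType.sign y * (z.toMul : ℚ), ⟨fun i => ?_, ?_⟩, hsign, ?_⟩
  · refine Fin.lastCases ?_ (fun i => ?_) i
    · rw [Fin.snoc_last, Fin.snoc_last, hsign]
    · rw [Fin.snoc_castSucc, Fin.snoc_castSucc, h.sign]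
  · rw [Fin.comp_snoc, Fin.comp_snoc, habs]
    exact hz
  · calc _ ≤ posHeight z := ratHeight_sign_mul_le _ _
      _ ≤ posHeight (b • z) := posHeight_le_nsmul hb z
      _ ≤ posHeight (linComb a (absPart ∘ x')) * posHeight (c • e) := by
        rw [hbz]
        exact posHeight_add_le _ _
      _ ≤ _ := by
        apply Nat.mul_le_mul
        · exact posHeight_linComb_le hxW (fun i => by exact_mod_cast ha i) hW
        · rw [posHeight_nsmul]
          exact (Nat.pow_le_pow_left he _).trans (Nat.pow_le_pow_right (by positivity) hc)

/-- Signs settle the case of value zero. For nonzero values the equation says that the combination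
with coefficients `countVar s - countVar t` vanishes, and these are at most `k + 1` in absolute
value. -/
theorem RatEquiv.termVal_eq_iff {k j : ℕ} {x x' : Fin n → ℚ} (h : RatEquiv k j x x')
    {s t : mulLang.Term (Empty ⊕ Fin n)} (hs : termCode s ≤ k) (ht : termCode t ≤ k) :
    termVal x s = termVal x t ↔ termVal x' s = termVal x' t := by
  have hsub : ∀ z : Fin n → PosRat, linComb (countVar s) z = linComb (countVar t) z ↔
      linComb (countVar s - countVar t) z = 0 := fun z => by rw [linComb_sub, sub_eq_zero]
  rw [eq_iff_sign_absPart, eq_iff_sign_absPart, sign_termVal h.sign s, sign_termVal h.sign t]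
  refine and_congr_right fun hst => ?_
  by_cases h0 : termVal x' s = 0
  · have h0' : termVal x s = 0 := by
      rw [← sign_eq_zero_iff, sign_termVal h.sign, h0, sign_zero]
    have h1 : termVal x' t = 0 := by rw [← sign_eq_zero_iff, ← hst, h0, sign_zero]
    have h1' : termVal x t = 0 := by
      rw [← sign_eq_zero_iff, sign_termVal h.sign, h1, sign_zero]
    rw [h0, h0', h1, h1']
  · have h0' : termVal x s ≠ 0 := by
      rwa [← sign_ne_zero, sign_termVal h.sign, sign_ne_zero]
    have h1 : termVal x' t ≠ 0 := by rwa [← sign_ne_zero, ← hst, sign_ne_zero]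
    have h1' : termVal x t ≠ 0 := by
      rwa [← sign_ne_zero, sign_termVal h.sign, sign_ne_zero]
    rw [absPart_termVal _ _ h0, absPart_termVal _ _ h0', absPart_termVal _ _ h1,
      absPart_termVal _ _ h1', hsub, hsub]
    refine h.lin.zero _ fun i => ?_
    have e1 := countVar_nonneg s i
    have e2 := countVar_nonneg t i
    have e3 := countVar_le s i
    have e4 := countVar_le t i
    have e5 := lt_level k j
    rw [Pi.sub_apply, abs_le]
    omega

/-- A set of rationals which is determined by the signs of its members. -/
def SignClosed (S : Set ℚ) : Prop :=
  ∀ q r, SignType.sign q = SignType.sign r → q ∈ S → r ∈ S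

theorem formulaCode_le_imp (φ ψ : mulLang.BoundedFormula Empty n) :
    formulaCode φ ≤ formulaCode (φ.imp ψ) ∧ formulaCode ψ ≤ formulaCode (φ.imp ψ) := by
  have h1 := Nat.left_le_pair (formulaCode φ) (formulaCode ψ)
  have h2 := Nat.right_le_pair (formulaCode φ) (formulaCode ψ)
  simp only [formulaCode]
  omega

theorem termCode_le_formulaCode_equal (s t : mulLang.Term (Empty ⊕ Fin n)) :
    termCode s ≤ formulaCode (.equal s t) ∧ termCode t ≤ formulaCode (.equal s t) := by
  have h1 := Nat.left_le_pair (termCode s) (termCode t)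
  have h2 := Nat.right_le_pair (termCode s) (termCode t)
  simp only [formulaCode]
  omega

theorem exists_ratHeight_bound (x : Fin n → ℚ) : ∃ W, 1 ≤ W ∧ ∀ i, ratHeight (x i) ≤ W :=
  ⟨1 + ∑ i, ratHeight (x i), by omega, fun i => (Finset.single_le_sum
    (f := fun i => ratHeight (x i)) (fun _ _ => Nat.zero_le _) (Finset.mem_univ i)).trans
    (by omega)⟩

/-- Equivalent tuples satisfy the same formulas. -/
theorem RatEquiv.sat_iff {S : Set ℚ} (hS : SignClosed S) {k : ℕ}
    (φ : mulLang.BoundedFormula Empty n) (hφ : formulaCode φ + n ≤ k) {x x' : Fin n → ℚ}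
    (h : RatEquiv k (k - n) x x') : Sat S φ x ↔ Sat S φ x' := by
  induction φ with
  | falsum => rfl
  | equal s t =>
    have := termCode_le_formulaCode_equal s t
    exact h.termVal_eq_iff (by omega) (by omega)
  | rel R _ => exact Empty.elim R
  | imp φ ψ h1 h2 =>
    have := formulaCode_le_imp φ ψ
    rw [Sat, Sat, h1 (by omega) h, h2 (by omega) h]
  | @all n φ ih =>
    simp only [formulaCode] at hφ
    -- Each quantifier adds a variable and spends one level; the code of the body is smaller by
    -- enough to keep `formulaCode φ + n ≤ k`.
    have hk : k - n = k - (n + 1) + 1 := by omega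
    rw [hk] at h
    have key : ∀ {x x' : Fin n → ℚ}, RatEquiv k (k - (n + 1) + 1) x x' →
        Sat S (.all φ) x → Sat S (.all φ) x' := by
      intro x x' h hx q hq
      obtain ⟨W, hW, hxW⟩ := exists_ratHeight_bound x
      obtain ⟨y, hy, hs, -⟩ := h.symm.extend q hW hxW
      exact (ih (by omega) hy.symm).1 (hx y (hS q y hs.symm hq))
    exact ⟨key h, key h.symm⟩

/-- Truth of a formula, with the quantifier on the `n`-th variable restricted to `D n`. -/
def BddSat (S : Set ℚ) (D : ℕ → Set ℚ) :
    {n : ℕ} → mulLang.BoundedFormula Empty n → (Fin n → ℚ) → Prop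
  | _, .falsum, _ => False
  | _, .equal s t, x => termVal x s = termVal x t
  | _, .rel R _, _ => Empty.elim R
  | _, .imp φ ψ, x => BddSat S D φ x → BddSat S D ψ x
  | n, .all φ, x => ∀ q ∈ S, q ∈ D n → BddSat S D φ (Fin.snoc x q)

/-- If the restricted ranges contain all rationals of sufficiently large height, then restricting
the quantifiers does not change the truth of a formula. -/
theorem sat_iff_bddSat {S : Set ℚ} (hS : SignClosed S) {k : ℕ} {D : ℕ → Set ℚ} {H : ℕ → ℕ}
    (hH : ∀ n, 1 ≤ H n) (hmono : Monotone H) (hD : ∀ n, ∀ q ∈ D n, ratHeight q ≤ H (n + 1))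
    (hHD : ∀ n q, ratHeight q ≤ witnessBound k (k - (n + 1)) n (H n) → q ∈ D n)
    (φ : mulLang.BoundedFormula Empty n) (hφ : formulaCode φ + n ≤ k) {x : Fin n → ℚ}
    (hx : ∀ i, ratHeight (x i) ≤ H n) : Sat S φ x ↔ BddSat S D φ x := by
  induction φ with
  | falsum => rfl
  | equal s t => rfl
  | rel R _ => exact Empty.elim R
  | imp φ ψ h1 h2 =>
    have := formulaCode_le_imp φ ψ
    rw [Sat, BddSat, h1 (by omega) hx, h2 (by omega) hx]
  | @all n φ ih =>
    simp only [formulaCode] at hφ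
    have hk : k - n = k - (n + 1) + 1 := by omega
    have ih' : ∀ q ∈ D n, (Sat S φ (Fin.snoc x q) ↔ BddSat S D φ (Fin.snoc x q)) := fun q hq =>
      ih (by omega) fun i => by
        refine Fin.lastCases ?_ (fun i => ?_) i
        · rw [Fin.snoc_last]
          exact hD n q hq
        · rw [Fin.snoc_castSucc]
          exact (hx i).trans (hmono n.le_succ)
    constructor
    · exact fun h q hq hqD => (ih' q hqD).1 (h q hq)
    · intro h q hq
      -- Extending the trivial equivalence of `x` with itself replaces an arbitrary `q` by a `y` of
      -- bounded height that has the same properties over `x`.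
      obtain ⟨y, hy, hs, hyW⟩ := (RatEquiv.refl k (k - (n + 1) + 1) x).extend q (hH n) hx
      have hyD := hHD n y hyW
      exact (hy.sat_iff hS φ (by omega)).2 ((ih' y hyD).2 (h y (hS q y hs.symm hq) hyD))

end Semantics

/-! ### Primitive recursive bounds and codes of rationals. -/

section Computability

open FirstOrder Language

/-- Course-of-values recursion: a value may depend on those at a computed list of arguments of
smaller measure. For syntax the measure is the code. -/
theorem exists_primrec_of_recursion {β σ : Type*} [Primcodable β] [Primcodable σ] {m : β → ℕ}
    {l : β → List β} {g : β → List σ → σ} (hm : Primrec m) (hl : Primrec l) (hg : Primrec₂ g)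
    (hord : ∀ b, ∀ b' ∈ l b, m b' < m b) :
    ∃ f : β → σ, Primrec f ∧ ∀ b, f b = g b ((l b).map f) := by
  let f : β → σ := (measure m).wf.fix fun b ih =>
    g b ((l b).attach.map fun b' => ih b'.1 (hord b b'.1 b'.2))
  have hf : ∀ b, f b = g b ((l b).map f) := fun b => by
    rw [← List.attach_map_val]
    exact (measure m).wf.fix_eq _ b
  exact ⟨f, Primrec.nat_omega_rec' f hm hl (Primrec.option_some.comp₂ hg) hord
    fun b => congrArg some (hf b).symm, hf⟩

theorem Primrec.nat_pow : Primrec₂ ((· ^ ·) : ℕ → ℕ → ℕ) :=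
  Primrec₂.unpaired'.1 Nat.Primrec.pow

theorem Primrec.nat_factorial : Primrec Nat.factorial :=
  (Primrec.nat_rec₁ (f := fun n r => (n + 1) * r) 1
    (Primrec.nat_mul.comp (Primrec.succ.comp .fst) .snd)).of_eq fun n => by
      induction n with
      | zero => rfl
      | succ n ih => simp only [Nat.factorial_succ, ← ih]

theorem primrec_level : Primrec₂ level := by
  have h : Primrec₂ fun (_ : ℕ × ℕ) (p : ℕ × ℕ × ℕ) =>
      (p.2.1 * p.2.2.factorial, 2 * p.2.2 ^ 2) := by
    have h1 : Primrec fun p : (ℕ × ℕ) × ℕ × ℕ × ℕ => p.2.2.1 :=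
      Primrec.fst.comp (Primrec.snd.comp .snd)
    have h2 : Primrec fun p : (ℕ × ℕ) × ℕ × ℕ × ℕ => p.2.2.2 :=
      Primrec.snd.comp (Primrec.snd.comp .snd)
    exact (Primrec.nat_mul.comp h1 (Primrec.nat_factorial.comp h2)).pair
      (Primrec.nat_mul.comp (.const 2) (Primrec.nat_pow.comp h2 (.const 2)))
  refine (Primrec.nat_rec' (f := Prod.snd) (g := fun p : ℕ × ℕ => (1, p.1 + 1)) .snd
    ((Primrec.const 1).pair (Primrec.succ.comp .fst)) h).of_eq fun ⟨k, j⟩ => ?_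
  induction j with
  | zero => rfl
  | succ j ih =>
    simp only [level]
    rw [← ih]

/-- A bound for the codes of the numbers to which the quantifier on the `n`-th variable is
restricted, if `W` bounds the heights of the previous ones. -/
def codeBound (k n W : ℕ) : ℕ := ((witnessBound k (k - (n + 1)) n W + 1) ^ 2 + 1) ^ 2

theorem primrec_codeBound : Primrec fun p : ℕ × ℕ × ℕ => codeBound p.1 p.2.1 p.2.2 := by
  have hk : Primrec fun p : ℕ × ℕ × ℕ => p.1 := .fst
  have hn : Primrec fun p : ℕ × ℕ × ℕ => p.2.1 := Primrec.fst.comp .snd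
  have hW : Primrec fun p : ℕ × ℕ × ℕ => p.2.2 := Primrec.snd.comp .snd
  have hl : Primrec fun p : ℕ × ℕ × ℕ => level p.1 (p.1 - (p.2.1 + 1)) :=
    primrec_level.comp hk (Primrec.nat_sub.comp hk (Primrec.succ.comp hn))
  have hl1 := Primrec.fst.comp hl
  have hl2 := Primrec.snd.comp hl
  have h1 : Primrec fun p : ℕ × ℕ × ℕ => witnessBound p.1 (p.1 - (p.2.1 + 1)) p.2.1 p.2.2 :=
    Primrec.nat_mul.comp
      (Primrec.nat_pow.comp (Primrec.nat_pow.comp hW (Primrec.nat_add.comp hl1 hl2)) hn)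
      (Primrec.nat_pow.comp (Primrec.succ.comp (Primrec.nat_factorial.comp hW)) hl1)
  exact Primrec.nat_pow.comp (Primrec.succ.comp
    (Primrec.nat_pow.comp (Primrec.succ.comp h1) (.const 2))) (.const 2)

attribute [irreducible] codeBound

/-- A bound for the heights of the numbers to which the quantifiers on the first `n` variables are
restricted. -/
def heightBound (k : ℕ) : ℕ → ℕ
  | 0 => 1
  | n + 1 => heightBound k n + codeBound k n (heightBound k n)

theorem primrec_heightBound : Primrec₂ heightBound := by
  have h1 : Primrec fun p : (ℕ × ℕ) × ℕ × ℕ => (p.1.1, p.2.1, p.2.2) :=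
    (Primrec.fst.comp .fst).pair .snd
  have h2 : Primrec fun p : (ℕ × ℕ) × ℕ × ℕ => codeBound p.1.1 p.2.1 p.2.2 :=
    primrec_codeBound.comp h1
  have h : Primrec₂ fun (p : ℕ × ℕ) (q : ℕ × ℕ) => q.2 + codeBound p.1 q.1 q.2 :=
    Primrec.nat_add.comp (Primrec.snd.comp .snd) h2
  refine (Primrec.nat_rec' (f := Prod.snd) (g := fun _ : ℕ × ℕ => 1) .snd (.const 1) h).of_eq
    fun ⟨k, n⟩ => ?_
  induction n with
  | zero => rfl
  | succ n ih =>
    simp only [heightBound]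
    rw [← ih]

/-- The bound for the codes of the values of the `n`-th variable. -/
def quantBound (k n : ℕ) : ℕ := codeBound k n (heightBound k n)

theorem primrec_quantBound : Primrec₂ quantBound := by
  have h : Primrec fun p : ℕ × ℕ => (p.1, p.2, heightBound p.1 p.2) :=
    Primrec.fst.pair (Primrec.snd.pair primrec_heightBound)
  have h' : Primrec fun p : ℕ × ℕ => codeBound p.1 p.2 (heightBound p.1 p.2) :=
    primrec_codeBound.comp h
  exact h'

/-- The rational `(-1) ^ s * (p / q)` represented by a triple `(s, p, q)`. -/
def tripVal (t : ℕ × ℕ × ℕ) : ℚ := (-1) ^ t.1 * (t.2.1 / t.2.2)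

/-- The product of rationals represented by triples. -/
def tripMul (t u : ℕ × ℕ × ℕ) : ℕ × ℕ × ℕ := (t.1 + u.1, t.2.1 * u.2.1, t.2.2 * u.2.2)

theorem tripVal_mul (t u : ℕ × ℕ × ℕ) : tripVal (tripMul t u) = tripVal t * tripVal u := by
  simp only [tripVal, tripMul, pow_add, Nat.cast_mul]
  ring

theorem primrec_tripMul : Primrec₂ tripMul := by
  have h1 : Primrec fun p : (ℕ × ℕ × ℕ) × ℕ × ℕ × ℕ => p.1.2 := Primrec.snd.comp .fst
  have h2 : Primrec fun p : (ℕ × ℕ × ℕ) × ℕ × ℕ × ℕ => p.2.2 := Primrec.snd.comp .snd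
  exact (Primrec.nat_add.comp (Primrec.fst.comp .fst) (Primrec.fst.comp .snd)).pair
    ((Primrec.nat_mul.comp (Primrec.fst.comp h1) (Primrec.fst.comp h2)).pair
      (Primrec.nat_mul.comp (Primrec.snd.comp h1) (Primrec.snd.comp h2)))

/-- Cross-multiplication compares absolute values and parity compares signs, which are irrelevant
when the numerator is zero. -/
theorem tripVal_eq_iff {t u : ℕ × ℕ × ℕ} (ht : t.2.2 ≠ 0) (hu : u.2.2 ≠ 0) :
    tripVal t = tripVal u ↔
      t.2.1 * u.2.2 = u.2.1 * t.2.2 ∧ (t.2.1 = 0 ∨ (t.1 + u.1) % 2 = 0) := by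
  obtain ⟨s, p, q⟩ := t
  obtain ⟨s', p', q'⟩ := u
  simp only [tripVal] at *
  have hq : (0 : ℚ) < q := by exact_mod_cast Nat.pos_of_ne_zero ht
  have hq' : (0 : ℚ) < q' := by exact_mod_cast Nat.pos_of_ne_zero hu
  have hp : (0 : ℚ) ≤ p / q := by positivity
  have hp' : (0 : ℚ) ≤ p' / q' := by positivity
  have hpq : ((p : ℚ) / q = p' / q') ↔ p * q' = p' * q := by
    rw [div_eq_div_iff hq.ne' hq'.ne']
    exact_mod_cast Iff.rfl
  have hp0 : ((p : ℚ) / q = 0) ↔ p = 0 := by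
    rw [div_eq_zero_iff, or_iff_left hq.ne', Nat.cast_eq_zero]
  rw [← hpq, ← hp0]
  rcases Nat.even_or_odd s with hs | hs <;> rcases Nat.even_or_odd s' with hs' | hs' <;>
    rw [hs.neg_one_pow, hs'.neg_one_pow]
  · have : (s + s') % 2 = 0 := Nat.even_iff.1 (hs.add hs')
    simp [this]
  · have : (s + s') % 2 = 1 := Nat.odd_iff.1 (hs.add_odd hs')
    simp only [this, one_mul, neg_one_mul]
    constructor
    · intro h
      constructor <;> [skip; left] <;> linarith
    · rintro ⟨h, h' | h'⟩
      · linarith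
      · omega
  · have : (s + s') % 2 = 1 := Nat.odd_iff.1 (hs.add_even hs')
    simp only [this, one_mul, neg_one_mul]
    constructor
    · intro h
      constructor <;> [skip; left] <;> linarith
    · rintro ⟨h, h' | h'⟩
      · linarith
      · omega
  · have : (s + s') % 2 = 0 := Nat.even_iff.1 (hs.add_odd hs')
    simp [this]

/-- The triple with a given code. -/
def toTrip (u : ℕ) : ℕ × ℕ × ℕ := Denumerable.ofNat (ℕ × ℕ × ℕ) u

theorem primrec_toTrip : Primrec toTrip := Primrec.ofNat _

theorem ratHeight_tripVal_le (u : ℕ) (h : (toTrip u).2.2 ≠ 0) :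
    ratHeight (tripVal (toTrip u)) ≤ u := by
  have e : toTrip u = (u.unpair.1, u.unpair.2.unpair.1, u.unpair.2.unpair.2) := by
    simp [toTrip]
  have h1 : (toTrip u).2.1 ≤ u := by
    rw [e]
    exact (Nat.unpair_left_le _).trans (Nat.unpair_right_le _)
  have h2 : (toTrip u).2.2 ≤ u := by
    rw [e]
    exact (Nat.unpair_right_le _).trans (Nat.unpair_right_le _)
  generalize toTrip u = t at h h1 h2
  obtain ⟨s, p, q⟩ := t
  have key : ratHeight ((p : ℚ) / q) ≤ u := by
    have hq : (q : ℤ) ≠ 0 := by exact_mod_cast h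
    have e2 : (p : ℚ) / q = Rat.divInt p q := by
      rw [Rat.divInt_eq_div]
      simp
    rw [e2]
    apply max_le
    · by_cases hp : p = 0
      · simp [hp]
      · have := Int.natAbs_dvd_natAbs.2 (Rat.num_dvd p hq)
        exact (Nat.le_of_dvd (by simpa using Nat.pos_of_ne_zero hp) this).trans (by simpa using h1)
    · have : ((Rat.divInt p q).den : ℤ) ∣ q := Rat.den_dvd p q
      exact (Nat.le_of_dvd (Nat.pos_of_ne_zero h) (by exact_mod_cast this)).trans h2
  rcases neg_one_pow_eq_or ℚ s with hs | hs <;> simp only [tripVal, hs]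
  · simpa using key
  · simpa [ratHeight_neg] using key

theorem exists_code_of_ratHeight_le {q : ℚ} {H : ℕ} (h : ratHeight q ≤ H) :
    ∃ u < ((H + 1) ^ 2 + 1) ^ 2, (toTrip u).2.2 ≠ 0 ∧ tripVal (toTrip u) = q := by
  have h1 : q.num.natAbs ≤ H := (le_max_left _ _).trans h
  have h2 : q.den ≤ H := (le_max_right _ _).trans h
  obtain ⟨s, hs1, hs⟩ : ∃ s : ℕ, s ≤ 1 ∧ (-1 : ℚ) ^ s * (q.num.natAbs / q.den) = q := by
    have e : q = q.num / q.den := (Rat.num_div_den q).symm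
    rcases Int.natAbs_eq q.num with h0 | h0
    · refine ⟨0, by omega, ?_⟩
      conv_rhs => rw [e, h0]
      simp
    · refine ⟨1, le_rfl, ?_⟩
      conv_rhs => rw [e, h0]
      rw [Int.cast_neg, Int.cast_natCast]
      ring
  have e : toTrip (Nat.pair s (Nat.pair q.num.natAbs q.den)) = (s, q.num.natAbs, q.den) := by
    simp [toTrip]
  refine ⟨Nat.pair s (Nat.pair q.num.natAbs q.den), ?_, ?_, ?_⟩
  -- Two nested pairings, each bounded by the square of one more than the maximum, give the shape of
  -- `codeBound`.
  · have h3 : Nat.pair q.num.natAbs q.den < (H + 1) ^ 2 :=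
      (Nat.pair_lt_max_add_one_sq _ _).trans_le
        (Nat.pow_le_pow_left (by simpa using ⟨h1, h2⟩) 2)
    refine (Nat.pair_lt_max_add_one_sq _ _).trans_le (Nat.pow_le_pow_left ?_ 2)
    have : 1 ≤ (H + 1) ^ 2 := Nat.one_le_pow _ _ (by omega)
    exact Nat.succ_le_succ (max_le (hs1.trans this) h3.le)
  · rw [e]
    exact q.den_ne_zero
  · rw [e]
    exact hs

/-- The values of the `n`-th variable to which the quantifiers are restricted. -/
def valueRange (k n : ℕ) : Set ℚ :=
  {q | ∃ u < quantBound k n, (toTrip u).2.2 ≠ 0 ∧ tripVal (toTrip u) = q}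

theorem sat_iff_bddSat_valueRange {S : Set ℚ} (hS : SignClosed S) {k : ℕ}
    (φ : mulLang.BoundedFormula Empty 0) (hφ : formulaCode φ ≤ k) (x : Fin 0 → ℚ) :
    Sat S φ x ↔ BddSat S (valueRange k) φ x := by
  refine sat_iff_bddSat hS (H := heightBound k) (fun n => ?_) (monotone_nat_of_le_succ fun n => ?_)
    ?_ (fun n q h => by
      unfold valueRange quantBound codeBound
      exact exists_code_of_ratHeight_le h) φ hφ fun i => i.elim0
  · induction n with
    | zero => rfl
    | succ n ih => exact ih.trans (Nat.le_add_right _ _)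
  · exact Nat.le_add_right _ _
  · rintro n q ⟨u, hu, h0, rfl⟩
    -- A rational has height at most any of its codes, so a bound on codes also bounds the heights
    -- passed to the next quantifier.
    exact (ratHeight_tripVal_le u h0).trans (hu.le.trans (Nat.le_add_left _ _))

end Computability

/-! ### Syntax and bounded truth evaluated on codes. -/

section Evaluation

open FirstOrder Language

theorem primrecPred_mod_eq {α : Type*} [Primcodable α] {f : α → ℕ} (hf : Primrec f) (m r : ℕ) :
    PrimrecPred fun a => f a % m = r :=
  Primrec.eq.comp (Primrec.nat_mod.comp hf (.const m)) (.const r)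

theorem primrec_unpair_div_left {α : Type*} [Primcodable α] {f : α → ℕ} (hf : Primrec f) (m : ℕ) :
    Primrec fun a => (f a / m).unpair.1 :=
  Primrec.fst.comp (Primrec.unpair.comp (Primrec.nat_div.comp hf (.const m)))

theorem primrec_unpair_div_right {α : Type*} [Primcodable α] {f : α → ℕ} (hf : Primrec f) (m : ℕ) :
    Primrec fun a => (f a / m).unpair.2 :=
  Primrec.snd.comp (Primrec.unpair.comp (Primrec.nat_div.comp hf (.const m)))

theorem primrec_pair_list {α β : Type*} [Primcodable α] [Primcodable β] {f g : α → β}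
    (hf : Primrec f) (hg : Primrec g) : Primrec fun a => [f a, g a] :=
  Primrec.list_cons.comp hf (Primrec.list_cons.comp hg (.const []))

theorem unpair_div_lt {c m : ℕ} (hm : 1 < m) (hc : 0 < c) :
    (c / m).unpair.1 < c ∧ (c / m).unpair.2 < c :=
  ⟨(Nat.unpair_left_le _).trans_lt (Nat.div_lt_self hc hm),
    (Nat.unpair_right_le _).trans_lt (Nat.div_lt_self hc hm)⟩

/-- Recursion on the codes of terms is primitive recursive. -/
theorem exists_primrec_termRec {α σ : Type*} [Primcodable α] [Primcodable σ] [Inhabited σ]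
    {v : α × ℕ → σ} {w : σ → σ → σ} (hv : Primrec v) (hw : Primrec₂ w) :
    ∃ f : α × ℕ → σ, Primrec f ∧ (∀ a i, f (a, 2 * i) = v (a, i)) ∧
      ∀ a s t, f (a, 2 * Nat.pair s t + 1) = w (f (a, s)) (f (a, t)) := by
  let l : α × ℕ → List (α × ℕ) := fun b =>
    if b.2 % 2 = 0 then [] else [(b.1, (b.2 / 2).unpair.1), (b.1, (b.2 / 2).unpair.2)]
  let g : α × ℕ → List σ → σ := fun b r =>
    if b.2 % 2 = 0 then v (b.1, b.2 / 2) else w r.headI r.tail.headI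
  have hl : Primrec l := Primrec.ite (primrecPred_mod_eq .snd 2 0) (.const [])
    (primrec_pair_list (Primrec.fst.pair (primrec_unpair_div_left .snd 2))
      (Primrec.fst.pair (primrec_unpair_div_right .snd 2)))
  have hg : Primrec₂ g := by
    have h1 : Primrec fun p : (α × ℕ) × List σ => p.1.2 := Primrec.snd.comp .fst
    exact Primrec.ite (primrecPred_mod_eq h1 2 0)
      (hv.comp ((Primrec.fst.comp .fst).pair (Primrec.nat_div.comp h1 (.const 2))))
      (hw.comp (Primrec.list_headI.comp .snd)
        (Primrec.list_headI.comp (Primrec.list_tail.comp .snd)))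
  obtain ⟨f, hf, h⟩ := exists_primrec_of_recursion Primrec.snd hl hg fun b b' hb' => by
    by_cases h0 : b.2 % 2 = 0
    · simp [l, h0] at hb'
    · have := unpair_div_lt (c := b.2) (m := 2) (by omega) (by omega)
      simp only [l, h0, if_false, List.mem_cons, List.not_mem_nil, or_false] at hb'
      rcases hb' with rfl | rfl
      · exact this.1
      · exact this.2
  refine ⟨f, hf, fun a i => ?_, fun a s t => ?_⟩
  · rw [h]
    simp [g]
  · have h1 : (2 * Nat.pair s t + 1) % 2 ≠ 0 := by omega
    have h2 : (2 * Nat.pair s t + 1) / 2 = Nat.pair s t := by omega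
    rw [h]
    simp only [g, l, h1, if_false, h2, Nat.unpair_pair, List.map_cons, List.map_nil, List.headI,
      List.tail]

/-- Recursion on the codes of formulas is primitive recursive. The function `q` lists the
parameters with which the value at the body of a quantified formula is needed. -/
theorem exists_primrec_formulaRec {α : Type*} [Primcodable α] {v : α × ℕ → Bool} {q : α → List α}
    {w : Bool → Bool → Bool} {z : Bool} (hv : Primrec v) (hq : Primrec q) :
    ∃ f : α × ℕ → Bool, Primrec f ∧ (∀ a, f (a, 0) = z) ∧
      (∀ a c, f (a, 4 * c + 4) = false) ∧
      (∀ a c, f (a, 4 * c + 1) = v (a, c)) ∧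
      (∀ a c d, f (a, 4 * Nat.pair c d + 2) = w (f (a, c)) (f (a, d))) ∧
      ∀ a c, f (a, 4 * c + 3) = decide (∀ a' ∈ q a, f (a', c) = true) := by
  let l : α × ℕ → List (α × ℕ) := fun b =>
    if b.2 % 4 = 2 then [(b.1, (b.2 / 4).unpair.1), (b.1, (b.2 / 4).unpair.2)]
    else if b.2 % 4 = 3 then (q b.1).map fun a => (a, b.2 / 4) else []
  let g : α × ℕ → List Bool → Bool := fun b r =>
    if b.2 % 4 = 2 then w r.headI r.tail.headI
    else if b.2 % 4 = 3 then decide (∀ x ∈ r, x = true)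
    else if b.2 % 4 = 1 then v (b.1, b.2 / 4)
    -- Positive multiples of 4 code no formula.
    else if b.2 = 0 then z else false
  have hl : Primrec l := by
    have h1 : Primrec fun b : α × ℕ => (q b.1).map fun a => (a, b.2 / 4) :=
      Primrec.list_map (hq.comp .fst)
        (Primrec.snd.pair (Primrec.nat_div.comp (Primrec.snd.comp .fst) (.const 4)))
    exact Primrec.ite (primrecPred_mod_eq .snd 4 2)
      (primrec_pair_list (Primrec.fst.pair (primrec_unpair_div_left .snd 4))
        (Primrec.fst.pair (primrec_unpair_div_right .snd 4)))
      (Primrec.ite (primrecPred_mod_eq .snd 4 3) h1 (.const []))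
  have hg : Primrec₂ g := by
    have h1 : Primrec fun p : (α × ℕ) × List Bool => p.1.2 := Primrec.snd.comp .fst
    have h2 : PrimrecPred fun p : (α × ℕ) × List Bool => ∀ x ∈ p.2, x = true :=
      (PrimrecPred.forall_mem_list (Primrec.eq.comp .id (.const true))).comp .snd
    exact Primrec.ite (primrecPred_mod_eq h1 4 2)
      ((Primrec.dom_finite (fun p : Bool × Bool => w p.1 p.2)).comp
        ((Primrec.list_headI.comp .snd).pair
          (Primrec.list_headI.comp (Primrec.list_tail.comp .snd))))
      (Primrec.ite (primrecPred_mod_eq h1 4 3) h2.decide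
        (Primrec.ite (primrecPred_mod_eq h1 4 1)
          (hv.comp ((Primrec.fst.comp .fst).pair (Primrec.nat_div.comp h1 (.const 4))))
          (Primrec.ite (Primrec.eq.comp h1 (.const 0)) (.const z) (.const false))))
  obtain ⟨f, hf, h⟩ := exists_primrec_of_recursion Primrec.snd hl hg fun b b' hb' => by
    by_cases h2 : b.2 % 4 = 2
    · have := unpair_div_lt (c := b.2) (m := 4) (by omega) (by omega)
      simp only [l, h2, if_true, List.mem_cons, List.not_mem_nil, or_false] at hb'
      rcases hb' with rfl | rfl
      · exact this.1
      · exact this.2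
    · by_cases h3 : b.2 % 4 = 3
      · obtain ⟨a, -, rfl⟩ : ∃ a ∈ q b.1, (a, b.2 / 4) = b' := by simpa [l, h3] using hb'
        exact Nat.div_lt_self (by omega) (by omega)
      · simp [l, h2, h3] at hb'
  refine ⟨f, hf, fun a => ?_, fun a c => ?_, fun a c => ?_, fun a c d => ?_, fun a c => ?_⟩
  · rw [h]
    simp [g]
  · have h1 : (4 * c + 4) % 4 = 0 := by omega
    rw [h]
    simp [g, h1]
  · have h1 : (4 * c + 1) % 4 = 1 := by omega
    have h2 : (4 * c + 1) / 4 = c := by omega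
    rw [h]
    simp [g, h1, h2]
  · have h1 : (4 * Nat.pair c d + 2) % 4 = 2 := by omega
    have h2 : (4 * Nat.pair c d + 2) / 4 = Nat.pair c d := by omega
    rw [h]
    simp only [g, l, h1, if_true, h2, Nat.unpair_pair, List.map_cons, List.map_nil, List.headI,
      List.tail]
  · have h1 : (4 * c + 3) % 4 = 3 := by omega
    have h2 : (4 * c + 3) / 4 = c := by omega
    rw [h]
    simp only [g, l, h1, h2, if_true, if_neg (show (3 : ℕ) ≠ 2 by decide)]
    exact decide_eq_decide.2 (by simp)

/-- The set of codes of terms in given variables is primitive recursive. -/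
theorem exists_primrec_isTermCode : ∃ f : ℕ × ℕ → Bool, Primrec f ∧
    ∀ n c, f (n, c) = true ↔ ∃ t : mulLang.Term (Empty ⊕ Fin n), termCode t = c := by
  obtain ⟨f, hf, hvar, hmul⟩ := exists_primrec_termRec
    (v := fun p : ℕ × ℕ => decide (p.2 < p.1)) (w := and)
    (PrimrecPred.decide (Primrec.nat_lt.comp .snd .fst)) Primrec.and
  refine ⟨f, hf, fun n c => ⟨fun h => ?_, ?_⟩⟩
  · induction c using Nat.strong_induction_on with
    | _ c ih =>
      rcases Nat.even_or_odd' c with ⟨i, rfl | rfl⟩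
      · rw [hvar, decide_eq_true_iff] at h
        exact ⟨.var (Sum.inr ⟨i, h⟩), rfl⟩
      · rw [← Nat.pair_unpair i, hmul, Bool.and_eq_true] at h
        have h1 := Nat.unpair_left_le i
        have h2 := Nat.unpair_right_le i
        obtain ⟨s, hs⟩ := ih _ (by omega) h.1
        obtain ⟨t, ht⟩ := ih _ (by omega) h.2
        refine ⟨.func MulFunc.mul ![s, t], ?_⟩
        simp [termCode, hs, ht]
  · rintro ⟨t, rfl⟩
    induction t using term_induction with
    | hvar i => simp [termCode, hvar]
    | hmul ts h0 h1 => simp [termCode, hmul, h0, h1]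

/-- The set of codes of formulas in given variables is primitive recursive. -/
theorem exists_primrec_isFormulaCode : ∃ f : ℕ × ℕ → Bool, Primrec f ∧
    ∀ n c, f (n, c) = true ↔ ∃ φ : mulLang.BoundedFormula Empty n, formulaCode φ = c := by
  obtain ⟨e, he, heq⟩ := exists_primrec_isTermCode
  obtain ⟨f, hf, hfalse, hnone, hequal, himp, hall⟩ := exists_primrec_formulaRec
    (v := fun p : ℕ × ℕ => e (p.1, p.2.unpair.1) && e (p.1, p.2.unpair.2))
    (q := fun n => [n + 1]) (w := and) (z := true)
    (Primrec.and.comp (he.comp (Primrec.fst.pair (Primrec.fst.comp (Primrec.unpair.comp .snd))))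
      (he.comp (Primrec.fst.pair (Primrec.snd.comp (Primrec.unpair.comp .snd)))))
    (Primrec.list_cons.comp .succ (.const []))
  refine ⟨f, hf, fun n c => ⟨fun h => ?_, ?_⟩⟩
  · induction c using Nat.strong_induction_on generalizing n with
    | _ c ih =>
      obtain rfl | ⟨d, rfl | rfl | rfl | rfl⟩ :
          c = 0 ∨ ∃ d, c = 4 * d + 4 ∨ c = 4 * d + 1 ∨ c = 4 * d + 2 ∨ c = 4 * d + 3 := by
        have : c % 4 = 0 ∨ c % 4 = 1 ∨ c % 4 = 2 ∨ c % 4 = 3 := by omega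
        rcases this with h | h | h | h
        · rcases Nat.eq_zero_or_pos c with h0 | h0
          · exact .inl h0
          · exact .inr ⟨c / 4 - 1, by omega⟩
        all_goals exact .inr ⟨c / 4, by omega⟩
      · exact ⟨.falsum, rfl⟩
      · rw [hnone] at h
        exact absurd h (by simp)
      · rw [hequal, Bool.and_eq_true, heq, heq] at h
        obtain ⟨⟨s, hs⟩, t, ht⟩ := h
        exact ⟨.equal s t, by simp [formulaCode, hs, ht]⟩
      · rw [← Nat.pair_unpair d, himp, Bool.and_eq_true] at h
        have h1 := Nat.unpair_left_le d
        have h2 := Nat.unpair_right_le d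
        obtain ⟨φ, hφ⟩ := ih _ (by omega) _ h.1
        obtain ⟨ψ, hψ⟩ := ih _ (by omega) _ h.2
        exact ⟨.imp φ ψ, by simp [formulaCode, hφ, hψ]⟩
      · rw [hall] at h
        obtain ⟨φ, hφ⟩ := ih d (by omega) (n + 1) (by simpa using h)
        exact ⟨.all φ, by simp [formulaCode, hφ]⟩
  · rintro ⟨φ, rfl⟩
    induction φ with
    | falsum => exact hfalse _
    | equal s t =>
      rw [formulaCode, hequal, Nat.unpair_pair, Bool.and_eq_true, heq, heq]
      exact ⟨⟨s, rfl⟩, t, rfl⟩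
    | rel R _ => exact Empty.elim R
    | imp φ ψ h1 h2 => rw [formulaCode, himp, h1, h2, Bool.and_true]
    | all φ ih =>
      rw [formulaCode, hall]
      simpa using ih

/-- The rationals coded by a list of natural numbers. -/
def envVal {n : ℕ} (env : List ℕ) (i : Fin n) : ℚ := tripVal (toTrip (env.getD i 0))

theorem envVal_append {n : ℕ} {env : List ℕ} (h : env.length = n) (u : ℕ) :
    (envVal (env ++ [u]) : Fin (n + 1) → ℚ) = Fin.snoc (envVal env) (tripVal (toTrip u)) := by
  subst h
  funext i
  refine Fin.lastCases ?_ (fun i => ?_) i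
  · simp [envVal]
  · rw [Fin.snoc_castSucc, envVal, envVal, List.getD_append _ _ _ _ (by simp)]
    rfl

/-- The value of a term can be computed from its code. -/
theorem exists_primrec_termVal : ∃ f : List ℕ × ℕ → ℕ × ℕ × ℕ, Primrec f ∧
    ∀ (n : ℕ) (env : List ℕ), (∀ i : Fin n, (toTrip (env.getD i 0)).2.2 ≠ 0) →
      ∀ t : mulLang.Term (Empty ⊕ Fin n), (f (env, termCode t)).2.2 ≠ 0 ∧
        tripVal (f (env, termCode t)) = termVal (envVal env) t := by
  obtain ⟨f, hf, hvar, hmul⟩ := exists_primrec_termRec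
    (v := fun p : List ℕ × ℕ => toTrip (p.1.getD p.2 0)) (w := tripMul)
    (primrec_toTrip.comp ((Primrec.list_getD 0).comp .fst .snd)) primrec_tripMul
  refine ⟨f, hf, fun n env henv t => ?_⟩
  induction t using term_induction with
  | hvar i =>
    rw [termCode, hvar]
    exact ⟨henv i, rfl⟩
  | hmul ts h0 h1 =>
    rw [termCode, hmul, tripVal_mul, h0.2, h1.2]
    exact ⟨mul_ne_zero h0.1 h1.1, rfl⟩

/-- Truth of formulas with restricted quantifiers is primitive recursive. -/
theorem exists_primrec_bddSat {S : Set ℚ} {valid : ℕ → Prop} (hvalid : PrimrecPred valid)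
    (hS : ∀ u, valid u ↔ (toTrip u).2.2 ≠ 0 ∧ tripVal (toTrip u) ∈ S) :
    ∃ f : (ℕ × List ℕ) × ℕ → Bool, Primrec f ∧
      ∀ (k n : ℕ) (env : List ℕ), env.length = n →
        (∀ i : Fin n, (toTrip (env.getD i 0)).2.2 ≠ 0) →
        ∀ φ : mulLang.BoundedFormula Empty n, f ((k, env), formulaCode φ) = true ↔
          BddSat S (valueRange k) φ (envVal env) := by
  classical
  obtain ⟨e, he, heq⟩ := exists_primrec_termVal
  have hv : PrimrecPred fun p : (ℕ × List ℕ) × ℕ =>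
      (e (p.1.2, p.2.unpair.1)).2.1 * (e (p.1.2, p.2.unpair.2)).2.2 =
        (e (p.1.2, p.2.unpair.2)).2.1 * (e (p.1.2, p.2.unpair.1)).2.2 ∧
      ((e (p.1.2, p.2.unpair.1)).2.1 = 0 ∨
        ((e (p.1.2, p.2.unpair.1)).1 + (e (p.1.2, p.2.unpair.2)).1) % 2 = 0) := by
    have h1 : Primrec fun p : (ℕ × List ℕ) × ℕ => e (p.1.2, p.2.unpair.1) :=
      he.comp ((Primrec.snd.comp .fst).pair (Primrec.fst.comp (Primrec.unpair.comp .snd)))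
    have h2 : Primrec fun p : (ℕ × List ℕ) × ℕ => e (p.1.2, p.2.unpair.2) :=
      he.comp ((Primrec.snd.comp .fst).pair (Primrec.snd.comp (Primrec.unpair.comp .snd)))
    have h1' := Primrec.fst.comp (Primrec.snd.comp h1)
    exact (Primrec.eq.comp (Primrec.nat_mul.comp h1' (Primrec.snd.comp (Primrec.snd.comp h2)))
        (Primrec.nat_mul.comp (Primrec.fst.comp (Primrec.snd.comp h2))
          (Primrec.snd.comp (Primrec.snd.comp h1)))).and
      ((Primrec.eq.comp h1' (.const 0)).or
        (primrecPred_mod_eq (Primrec.nat_add.comp (Primrec.fst.comp h1) (Primrec.fst.comp h2)) 2 0))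
  have hq : Primrec fun p : ℕ × List ℕ =>
      -- The length of the environment is the index of the variable being quantified.
      ((List.range (quantBound p.1 p.2.length)).filter (valid ·)).map fun u => (p.1, p.2 ++ [u]) := by
    refine Primrec.list_map ((Primrec.listFilter hvalid).comp (Primrec.list_range.comp
      (primrec_quantBound.comp .fst (Primrec.list_length.comp .snd)))) ?_
    exact (Primrec.fst.comp .fst).pair (Primrec.list_concat.comp (Primrec.snd.comp .fst) .snd)
  obtain ⟨f, hf, hfalse, -, hequal, himp, hall⟩ := exists_primrec_formulaRec
    (w := fun a b => !a || b) (z := false) hv.decide hq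
  refine ⟨f, hf, fun k n env hn henv φ => ?_⟩
  induction φ generalizing env with
  | falsum => simp [formulaCode, hfalse, BddSat]
  | @equal n s t =>
    have h1 := heq n env henv s
    have h2 := heq n env henv t
    rw [formulaCode, hequal, decide_eq_true_iff, Nat.unpair_pair, ← tripVal_eq_iff h1.1 h2.1, h1.2,
      h2.2, BddSat]
  | rel R _ => exact Empty.elim R
  | imp φ ψ h1 h2 =>
    rw [formulaCode, himp, BddSat, ← h1 env hn henv, ← h2 env hn henv]
    cases f ((k, env), formulaCode φ) <;> simp
  | @all n φ ih =>
    have hne : ∀ u, valid u → ∀ i : Fin (n + 1), (toTrip ((env ++ [u]).getD i 0)).2.2 ≠ 0 := by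
      intro u hu i
      refine Fin.lastCases ?_ (fun i => ?_) i
      · simpa [← hn] using ((hS u).1 hu).1
      · rw [List.getD_append _ _ _ _ (by simp [hn])]
        exact henv i
    rw [formulaCode, hall, decide_eq_true_iff, BddSat]
    simp only [List.mem_map, List.mem_filter, List.mem_range, decide_eq_true_iff,
      forall_exists_index, and_imp]
    constructor
    · rintro h _ hq ⟨u, hu, h0, rfl⟩
      have huv : valid u := (hS u).2 ⟨h0, hq⟩
      rw [← envVal_append hn, ← ih _ (by simp [hn]) (hne u huv)]
      exact h _ u (by rwa [hn]) huv rfl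
    · rintro h _ u hu huv rfl
      rw [ih _ (by simp [hn]) (hne u huv), envVal_append hn]
      exact h _ ((hS u).1 huv).2 ⟨u, by rwa [← hn], ((hS u).1 huv).1, rfl⟩

/-- A multiplicative structure isomorphic to one on a set of rationals which is determined by
signs, and recursive in this sense, has a decidable theory. -/
theorem isDecidableTheory_of_signClosed {M : Type} [Mul M] (f : M →ₙ* ℚ)
    (hf : Function.Injective f) (hsign : SignClosed (Set.range f)) {valid : ℕ → Prop}
    (hvalid : PrimrecPred valid)
    (hS : ∀ u, valid u ↔ (toTrip u).2.2 ≠ 0 ∧ tripVal (toTrip u) ∈ Set.range f) :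
    IsDecidableTheory (mulLang.completeTheory M) := by
  obtain ⟨e, he, heq⟩ := exists_primrec_isFormulaCode
  obtain ⟨g, hg, hgeq⟩ := exists_primrec_bddSat hvalid hS
  -- The number `k` plays two roles: it codes the sentence and is the parameter that fixes the
  -- quantifier ranges.
  have h : PrimrecPred fun k : ℕ => e (0, k) = true ∧ g ((k, []), k) = true :=
    (Primrec.eq.comp (he.comp ((Primrec.const 0).pair .id)) (.const true)).and
      (Primrec.eq.comp (hg.comp ((Primrec.id.pair (.const [])).pair .id)) (.const true))
  refine h.computablePred.of_eq fun k => ?_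
  have key : ∀ φ : mulLang.Sentence,
      g ((formulaCode φ, []), formulaCode φ) = true ↔ φ ∈ mulLang.completeTheory M := by
    intro φ
    rw [hgeq _ 0 [] rfl (fun i => i.elim0) φ, ← sat_iff_bddSat_valueRange hsign φ le_rfl,
      mem_completeTheory, Sentence.Realize, Formula.Realize, realize_iff_sat f hf]
    rw [Subsingleton.elim (envVal [] : Fin 0 → ℚ)]
  rw [heq]
  constructor
  · rintro ⟨⟨φ, rfl⟩, h⟩
    exact ⟨φ, (key φ).1 h, rfl⟩
  · rintro ⟨φ, hφ, rfl⟩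
    exact ⟨⟨φ, rfl⟩, (key φ).2 hφ⟩

theorem tripVal_eq_zero_iff {t : ℕ × ℕ × ℕ} (h : t.2.2 ≠ 0) : tripVal t = 0 ↔ t.2.1 = 0 := by
  simp [tripVal, h]

theorem tripVal_pos_iff {t : ℕ × ℕ × ℕ} (h : t.2.2 ≠ 0) :
    0 < tripVal t ↔ t.2.1 ≠ 0 ∧ t.1 % 2 = 0 := by
  have hq : (0 : ℚ) < t.2.2 := by exact_mod_cast Nat.pos_of_ne_zero h
  have hp : (0 : ℚ) ≤ t.2.1 / t.2.2 := by positivity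
  rw [← Nat.even_iff]
  rcases Nat.even_or_odd t.1 with hs | hs
  · simp [tripVal, hs.neg_one_pow, hs, div_pos_iff_of_pos_right hq, Nat.pos_iff_ne_zero]
  · rw [tripVal, hs.neg_one_pow]
    refine iff_of_false (by linarith) fun h0 => ?_
    exact (Nat.not_even_iff_odd.2 hs) h0.2

end Evaluation

theorem mainTheorem2 :
    IsDecidableTheory (mulLang.completeTheory {q : ℚ // 0 < q}) ∧
    IsDecidableTheory (mulLang.completeTheory {q : ℚ // 0 ≤ q}) ∧
    IsDecidableTheory (mulLang.completeTheory ℚ) := by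
  have hs := Primrec.fst.comp primrec_toTrip
  have hp := Primrec.fst.comp (Primrec.snd.comp primrec_toTrip)
  have hden : PrimrecPred fun u => (toTrip u).2.2 ≠ 0 :=
    (Primrec.eq.comp (Primrec.snd.comp (Primrec.snd.comp primrec_toTrip)) (.const 0)).not
  have hzero : PrimrecPred fun u => (toTrip u).2.1 = 0 := Primrec.eq.comp hp (.const 0)
  have hpos : PrimrecPred fun u => (toTrip u).2.1 ≠ 0 ∧ (toTrip u).1 % 2 = 0 :=
    hzero.not.and (primrecPred_mod_eq hs 2 0)
  -- Membership in each set is read off a code: a nonzero denominator, then conditions on the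
  -- numerator and on the parity of the sign exponent.
  refine ⟨isDecidableTheory_of_signClosed ⟨Subtype.val, fun _ _ => rfl⟩ Subtype.val_injective ?_
      (hden.and hpos) fun u => and_congr_right fun h => ?_,
    isDecidableTheory_of_signClosed ⟨Subtype.val, fun _ _ => rfl⟩ Subtype.val_injective ?_
      (hden.and (hzero.or hpos)) fun u => and_congr_right fun h => ?_,
    isDecidableTheory_of_signClosed (MulHom.id ℚ) Function.injective_id ?_ hden fun u => ?_⟩
  · rintro q r h ⟨⟨q, hq⟩, rfl⟩
    refine ⟨⟨r, ?_⟩, rfl⟩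
    rwa [← sign_eq_one_iff, ← h, sign_eq_one_iff]
  · rw [← tripVal_pos_iff h]
    exact ⟨fun h => ⟨⟨_, h⟩, rfl⟩, by rintro ⟨⟨q, hq⟩, h⟩; exact hq.trans_eq h⟩
  · rintro q r h ⟨⟨q, hq⟩, rfl⟩
    refine ⟨⟨r, ?_⟩, rfl⟩
    rwa [← sign_nonneg_iff, ← h, sign_nonneg_iff]
  · rw [← tripVal_pos_iff h, ← tripVal_eq_zero_iff h, eq_comm, ← le_iff_eq_or_lt]
    exact ⟨fun h => ⟨⟨_, h⟩, rfl⟩, by rintro ⟨⟨q, hq⟩, h⟩; exact hq.trans_eq h⟩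
  · exact fun _ r _ _ => ⟨r, rfl⟩
  · exact ⟨fun h => ⟨h, _, rfl⟩, fun h => h.1⟩
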